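/- For $n\ge 1$, $p\in(0,1)$ and a family $\mathcal F\subset 2^{[n]}$ of subsets of $[n]=\{1,\dots,n\}$ let $$\mu_p(\mathcal F)=\sum_{F\in\mathcal F}p^{|F|}(1-p)^{n-|F|}.$$ Families $\mathcal F,\mathcal G\subset 2^{[n]}$ are called cross-intersecting if $F\cap G\ne\emptyset$ for all $F\in\mathcal F$ and $G\in\mathcal G$. For $j\ge 0$ and $n\ge j+2$ let $$\mathcal A_j=\{A\subset[n]:1\in A\}\sqcup\{A\subset[n]:A\cap[j+2]=[j+2]\setminus\{1\}\},$$ $$\mathcal B_j=\{B\subset[n]:1\in B\}\setminus\{B\subset[n]:B\cap[j+2]=\{1\}\};$$ the values $\mu_p(\mathcal A_j)$ and $\mu_p(\mathcal B_j)$ do not depend on the choice of $n\ge j+2$. **Theorem.** Let $\alpha,\beta$ be real numbers with $\alpha>0$, $\beta>\frac12$ and $\alpha+\beta<1$. Suppose that $\mu_\alpha(\mathcal A_j)\,\mu_\beta(\mathcal B_j)<\alpha\beta$ for every integer $j\ge 0$. Then, for every $n\ge 1$, $$\max\{\mu_\alpha(\mathcal F)\,\mu_\beta(\mathcal G):\ \mathcal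 F,\mathcal G\subset 2^{[n]}\text{ cross-intersecting}\}=\alpha\beta.$$ -/

import Mathlib

/-- Families of subsets of `[n]` are modelled as `Finset (Finset (Fin n))`; the element `i + 1`
of `[n]` corresponds to `i : Fin n`, so that `1 ∈ [n]` corresponds to `0`.
Two families are cross-intersecting if every member of one meets every member of the other. -/
def CrossIntersecting {n : ℕ} (F G : Finset (Finset (Fin n))) : Prop :=
  ∀ A ∈ F, ∀ B ∈ G, (A ∩ B).Nonempty

/-- The `p`-biased measure of a family of subsets of `[n]`. -/
noncomputable def biasedMeasure {n : ℕ} (p : ℝ) (F : Finset (Finset (Fin n))) : ℝ :=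
  ∑ A ∈ F, p ^ A.card * (1 - p) ^ (n - A.card)

/-- The initial segment `[m]` of `[n]` (its first `m` elements, when `m ≤ n`). -/
def initSegment (n m : ℕ) : Finset (Fin n) :=
  {i | i.val < m}

/-- The modified star `A_j` on `[n]` (meant for `j + 2 ≤ n`). -/
def modifiedStarA (n j : ℕ) [NeZero n] : Finset (Finset (Fin n)) :=
  (Finset.univ.filter fun A => 0 ∈ A) ∪
    (Finset.univ.filter fun A => A ∩ initSegment n (j + 2) = initSegment n (j + 2) \ {0})

/-- The modified star `B_j` on `[n]` (meant for `j + 2 ≤ n`). -/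
def modifiedStarB (n j : ℕ) [NeZero n] : Finset (Finset (Fin n)) :=
  (Finset.univ.filter fun B => 0 ∈ B) \
    (Finset.univ.filter fun B => B ∩ initSegment n (j + 2) = {0})

/-- The open triangle `Ω`. -/
def triangleOmega : Set (ℝ × ℝ) :=
  {q | 0 < q.1 ∧ 1 / 2 < q.2 ∧ q.1 + q.2 < 1}

/-- All values `μ_α(F) μ_β(G)` for cross-intersecting families `F`, `G` of subsets of `[n]`. -/
def crossProducts (n : ℕ) (α β : ℝ) : Set ℝ :=
  {x | ∃ F G : Finset (Finset (Fin n)),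
    CrossIntersecting F G ∧ x = biasedMeasure α F * biasedMeasure β G}

/-!
The extremal value is attained by two stars. For the upper bound let `U` be the up-closure of `F`
and put `b = 1 - β`. No complement of a member of `G` lies in `U`, so `μ_β(G) ≤ 1 - μ_b(U)`.
Induction on the dimension gives `μ_α(U) ≤ f (μ_b(U))` for every function `f` with `f 0 = 0`,
`f 1 = 1` and `(1 - α) f(x) + α f(y) ≤ f((1 - b) x + b y)` for `x ≤ y`. It therefore suffices to
find, for each `m`, such an `f` with `f(m) (1 - m) ≤ α (1 - b)`.

The map that rescales odds so that `b` goes to `α` is such a function, and it settles `m ≤ b`. More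
are produced by the step that prepends a coordinate to the lexicographic order: the new function
consists of two rescaled copies of the old one, over `[0, b]` and `[b, 1]`. For `m = b + (1 - b) s`
with `b ^ (k + 1) ≤ s ≤ b ^ k`, iterating the step `k + 2` times turns the required inequality into
a quadratic one on this block, which follows from its cases at the two endpoints; at `s = b ^ k`
for `k ≥ 1` this is the hypothesis on `A_(k-1)` and `B_(k-1)`.
-/

open scoped AddConstMap

section Odds

/-- The odds `p / (1 - p)` of a probability `p`. -/
noncomputable def odds (p : ℝ) : ℝ :=
  p / (1 - p)

variable {p q : ℝ}

lemma odds_mul_one_sub (hp : p < 1) : odds p * (1 - p) = p :=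
  div_mul_cancel₀ p (sub_pos.2 hp).ne'

lemma odds_pos (hp0 : 0 < p) (hp1 : p < 1) : 0 < odds p :=
  div_pos hp0 (sub_pos.2 hp1)

lemma odds_le_one (hp : p ≤ 1 / 2) : odds p ≤ 1 :=
  (div_le_one (by linarith)).2 (by linarith)

lemma le_one_sub_mul_odds (hpq : p ≤ q) (hq : q < 1) : p ≤ (1 - p) * odds q := by
  rw [odds, mul_div_assoc', le_div_iff₀ (sub_pos.2 hq)]
  linarith

end Odds

section Lift

lemma mkFract_apply_of_mem (f : Set.Ico (0 : ℝ) 1 → ℝ) {x : ℝ} (hx : x ∈ Set.Ico 0 1) :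
    (AddConstMap.mkFract 1 f : ℝ →+c[1, 1] ℝ) x = f ⟨x, hx⟩ :=
  congrFun ((AddConstMap.mkFract 1).symm_apply_apply f) ⟨x, hx⟩

lemma map_add_map_le_of_Ico (F : ℝ →+c[1, 1] ℝ)
    (hF : ∀ x y, 0 ≤ x → x ≤ y → y < 1 → F x + F y ≤ F (x + y)) (x y : ℝ) :
    F x + F y ≤ F (x + y) := by
  have hfract : F (Int.fract x) + F (Int.fract y) ≤ F (Int.fract x + Int.fract y) := by
    rcases le_total (Int.fract x) (Int.fract y) with h | h
    · exact hF _ _ (Int.fract_nonneg x) h (Int.fract_lt_one y)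
    · rw [add_comm, add_comm (Int.fract x)]
      exact hF _ _ (Int.fract_nonneg y) h (Int.fract_lt_one x)
  have hsum : F (x + y) = F (Int.fract x + Int.fract y) + (⌊x⌋ + ⌊y⌋ : ℤ) := by
    rw [← AddConstMapClass.map_add_int]
    congr 1
    push_cast [Int.fract]
    ring
  have hx := AddConstMapClass.map_fract F x
  have hy := AddConstMapClass.map_fract F y
  rw [zsmul_one] at hx hy
  push_cast at hsum
  linarith

end Lift

/-- Prepending one coordinate to the lexicographic order. If `F` sends the `b`-measure of an
initial segment of the lexicographic order on a cube to its `a`-measure, then `lexStep a b F` does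
so for the cube with one more coordinate. Such functions on `[0, 1]` are extended to `ℝ` by
`F (x + 1) = F x + 1`. -/
noncomputable def lexStep (a b : ℝ) (F : ℝ →+c[1, 1] ℝ) : ℝ →+c[1, 1] ℝ :=
  AddConstMap.mkFract 1 fun x =>
    if (x : ℝ) ≤ b then a * F (x / b) else a + (1 - a) * F ((x - b) / (1 - b))

/-- The properties of the map from `b`-measure to `a`-measure of lexicographic initial segments
that are inherited by `lexStep`. The first four serve to prove the last one, which drives the
induction on the dimension of the cube. -/
structure IsLexProfile (a b : ℝ) (F : ℝ →+c[1, 1] ℝ) : Prop where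
  map_zero : F 0 = 0
  add_le : ∀ x y, F x + F y ≤ F (x + y)
  le_map_odds_mul : ∀ x, 0 ≤ x → x ≤ 1 → a * F x ≤ (1 - a) * F (odds b * x)
  map_odds_mul_le : ∀ x, -1 ≤ x → x ≤ 0 → (1 - a) * F (odds b * x) ≤ a * F x
  two_point : ∀ x y, 0 ≤ x → x ≤ y → y ≤ 1 →
    (1 - a) * F x + a * F y ≤ F ((1 - b) * x + b * y)

section LexStep

variable {a b : ℝ} {F : ℝ →+c[1, 1] ℝ}

lemma lexStep_mul (hb0 : 0 < b) (hb1 : b < 1) (F : ℝ →+c[1, 1] ℝ) {t : ℝ} (ht0 : 0 ≤ t)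
    (ht1 : t ≤ 1) : lexStep a b F (b * t) = a * F t := by
  have hbt : b * t ≤ b := mul_le_of_le_one_right hb0.le ht1
  rw [lexStep, mkFract_apply_of_mem _ ⟨by positivity, hbt.trans_lt hb1⟩]
  simp only [if_pos hbt, mul_div_cancel_left₀ _ hb0.ne']

lemma lexStep_zero (hb0 : 0 < b) (hb1 : b < 1) (hF : F 0 = 0) : lexStep a b F 0 = 0 := by
  simpa [hF] using lexStep_mul (a := a) hb0 hb1 F le_rfl zero_le_one

lemma lexStep_add_mul (hb0 : 0 < b) (hb1 : b < 1) (hF : F 0 = 0) {t : ℝ} (ht0 : 0 ≤ t)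
    (ht1 : t ≤ 1) : lexStep a b F (b + (1 - b) * t) = a + (1 - a) * F t := by
  have hF1 : F 1 = 1 := by simpa [hF] using AddConstMapClass.map_one F
  rcases ht0.eq_or_lt with rfl | ht0
  · simpa [hF, hF1] using lexStep_mul (a := a) hb0 hb1 F zero_le_one le_rfl
  rcases ht1.eq_or_lt with rfl | ht1
  · have h := AddConstMapClass.map_one (lexStep a b F)
    simpa [hF1, lexStep_zero hb0 hb1 hF] using h
  · have hpos : 0 < (1 - b) * t := mul_pos (by linarith) ht0
    have hlt : (1 - b) * t < 1 - b := mul_lt_of_lt_one_right (by linarith) ht1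
    have hnot : ¬ b + (1 - b) * t ≤ b := by linarith
    rw [lexStep, mkFract_apply_of_mem _ ⟨by linarith, by linarith⟩]
    simp only [if_neg hnot, add_sub_cancel_left, mul_div_cancel_left₀ _ (sub_pos.2 hb1).ne']

lemma lexStep_iterate_pow_mul (hb0 : 0 < b) (hb1 : b < 1) (F : ℝ →+c[1, 1] ℝ) {t : ℝ}
    (ht0 : 0 ≤ t) (ht1 : t ≤ 1) (k : ℕ) :
    (lexStep a b)^[k] F (b ^ k * t) = a ^ k * F t := by
  induction k with
  | zero => simp
  | succ k ih =>
    have h1 : b ^ k * t ≤ 1 := mul_le_one₀ (pow_le_one₀ hb0.le hb1.le) ht0 ht1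
    rw [Function.iterate_succ_apply', pow_succ', mul_assoc,
      lexStep_mul hb0 hb1 _ (by positivity) h1, ih, pow_succ', mul_assoc]

lemma exists_eq_mul_of_lt (hb0 : 0 < b) {x : ℝ} (hx0 : 0 ≤ x) (hxb : x < b) :
    ∃ t, 0 ≤ t ∧ t < 1 ∧ x = b * t :=
  ⟨x / b, by positivity, (div_lt_one hb0).2 hxb, (mul_div_cancel₀ x hb0.ne').symm⟩

lemma exists_eq_add_mul_of_le (hb1 : b < 1) {x : ℝ} (hbx : b ≤ x) (hx1 : x ≤ 1) :
    ∃ t, 0 ≤ t ∧ t ≤ 1 ∧ x = b + (1 - b) * t := by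
  have hb' : 0 < 1 - b := sub_pos.2 hb1
  refine ⟨(x - b) / (1 - b), div_nonneg (by linarith) hb'.le, (div_le_one hb').2 (by linarith), ?_⟩
  rw [mul_div_cancel₀ _ hb'.ne', add_sub_cancel]

end LexStep

namespace IsLexProfile

variable {a b : ℝ} {F : ℝ →+c[1, 1] ℝ}

lemma map_one (hF : IsLexProfile a b F) : F 1 = 1 := by
  simpa [hF.map_zero] using AddConstMapClass.map_one F

lemma le_map_odds (hF : IsLexProfile a b F) : a ≤ (1 - a) * F (odds b) := by
  simpa [hF.map_one] using hF.le_map_odds_mul 1 zero_le_one le_rfl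

lemma mul_le_lexStep_mul (hF : IsLexProfile a b F) (hb0 : 0 < b) (hb : b ≤ 1 / 2) {s : ℝ}
    (hs0 : 0 ≤ s) (hs2 : s ≤ 2) : a * F s ≤ lexStep a b F (b * s) := by
  have hb1 : b < 1 := by linarith
  rcases le_total s 1 with hs | hs
  · exact (lexStep_mul hb0 hb1 F hs0 hs).ge
  · have hs' : 0 ≤ s - 1 := sub_nonneg.2 hs
    have hθ0 := (odds_pos hb0 hb1).le
    have hθs : odds b * (s - 1) ≤ 1 := mul_le_one₀ (odds_le_one hb) hs' (by linarith)
    have hbs : b * s = b + (1 - b) * (odds b * (s - 1)) := by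
      linear_combination (1 - s) * odds_mul_one_sub hb1
    rw [hbs, lexStep_add_mul hb0 hb1 hF.map_zero (by positivity) hθs]
    calc a * F s = a + a * F (s - 1) := by rw [AddConstMapClass.map_sub_one]; ring
      _ ≤ a + (1 - a) * F (odds b * (s - 1)) :=
        add_le_add_right (hF.le_map_odds_mul _ hs' (by linarith)) a

lemma add_mul_le_lexStep_add_mul (hF : IsLexProfile a b F) (hb0 : 0 < b) (hb1 : b < 1) {t : ℝ}
    (ht : -odds b ≤ t) (ht1 : t ≤ 1) : a + (1 - a) * F t ≤ lexStep a b F (b + (1 - b) * t) := by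
  rcases le_total 0 t with ht0 | ht0
  · exact (lexStep_add_mul hb0 hb1 hF.map_zero ht0 ht1).ge
  · have hθ := odds_pos hb0 hb1
    obtain ⟨w, rfl⟩ : ∃ w, t = odds b * w := ⟨t / odds b, (mul_div_cancel₀ t hθ.ne').symm⟩
    have hw0 : w ≤ 0 := nonpos_of_mul_nonpos_right ht0 hθ
    have hw1 : -1 ≤ w := by
      refine le_of_mul_le_mul_left ?_ hθ
      linarith
    have hbw : b + (1 - b) * (odds b * w) = b * (w + 1) := by
      linear_combination w * odds_mul_one_sub hb1
    rw [hbw, lexStep_mul hb0 hb1 F (by linarith) (by linarith), AddConstMapClass.map_add_one,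
      mul_add, mul_one, add_comm (a * F w)]
    exact add_le_add_right (hF.map_odds_mul_le w hw1 hw0) a

lemma lexStep_low_add_high_le (hF : IsLexProfile a b F) (ha0 : 0 < a) (ha1 : a < 1) (hb0 : 0 < b)
    (hb1 : b < 1) {u v : ℝ} (hu0 : 0 ≤ u) (hu1 : u ≤ 1) (hv0 : 0 ≤ v) (hv1 : v ≤ 1) :
    a * F u + (a + (1 - a) * F v) ≤ lexStep a b F (b * u + (b + (1 - b) * v)) := by
  have : 0 ≤ 1 - a := by linarith
  have hθb := odds_mul_one_sub hb1
  have hθ := odds_pos hb0 hb1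
  rcases le_total (odds b * u + v) 1 with h | h
  · have hsum : b * u + (b + (1 - b) * v) = b + (1 - b) * (odds b * u + v) := by
      linear_combination -u * hθb
    rw [hsum, lexStep_add_mul hb0 hb1 hF.map_zero (by positivity) h]
    calc a * F u + (a + (1 - a) * F v)
        ≤ a + (1 - a) * (F (odds b * u) + F v) := by linarith [hF.le_map_odds_mul u hu0 hu1]
      _ ≤ a + (1 - a) * F (odds b * u + v) := by gcongr; exact hF.add_le _ _
  · obtain ⟨d, hd⟩ : ∃ d, odds b * d = 1 - v := ⟨(1 - v) / odds b, mul_div_cancel₀ _ hθ.ne'⟩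
    have hd0 : 0 ≤ d := nonneg_of_mul_nonneg_right (by linarith) hθ
    have hdu : d ≤ u := le_of_mul_le_mul_left (by linarith) hθ
    have hsum : b * u + (b + (1 - b) * v) = b * (u - d) + 1 := by
      linear_combination (1 - b) * hd - d * hθb
    have hscale := hF.map_odds_mul_le (-d) (by linarith) (by linarith)
    rw [show odds b * -d = v - 1 by linarith, AddConstMapClass.map_sub_one] at hscale
    rw [hsum, AddConstMapClass.map_add_one, lexStep_mul hb0 hb1 F (by linarith) (by linarith)]
    calc a * F u + (a + (1 - a) * F v) ≤ a * (F u + F (-d)) + 1 := by linarith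
      _ ≤ a * F (u - d) + 1 := by gcongr; exact hF.add_le _ _

lemma lexStep_high_add_high_le (hF : IsLexProfile a b F) (ha1 : a < 1) (hb0 : 0 < b)
    (hb1 : b < 1) {u v : ℝ} (hu0 : 0 ≤ u) (hu1 : u ≤ 1) (hv0 : 0 ≤ v) (hv1 : v ≤ 1) :
    a + (1 - a) * F u + (a + (1 - a) * F v) ≤
      lexStep a b F (b + (1 - b) * u + (b + (1 - b) * v)) := by
  have : 0 ≤ 1 - a := by linarith
  have hθ := odds_pos hb0 hb1
  have huv := hF.add_le u v
  rcases le_total (-odds b) (u + v - 1) with h | h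
  · have hsum : b + (1 - b) * u + (b + (1 - b) * v) = b + (1 - b) * (u + v - 1) + 1 := by ring
    rw [hsum, AddConstMapClass.map_add_one]
    calc a + (1 - a) * F u + (a + (1 - a) * F v) = 2 * a + (1 - a) * (F u + F v) := by ring
      _ ≤ 2 * a + (1 - a) * F (u + v) := by gcongr
      _ = a + (1 - a) * F (u + v - 1) + 1 := by rw [AddConstMapClass.map_sub_one]; ring
      _ ≤ _ := by gcongr; exact hF.add_mul_le_lexStep_add_mul hb0 hb1 h (by linarith)
  · have hsum : b + (1 - b) * u + (b + (1 - b) * v) = b + (1 - b) * (odds b + (u + v)) := by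
      linear_combination -odds_mul_one_sub hb1
    rw [hsum, lexStep_add_mul hb0 hb1 hF.map_zero (by positivity) (by linarith)]
    calc a + (1 - a) * F u + (a + (1 - a) * F v)
        ≤ a + (1 - a) * (F (odds b) + (F u + F v)) := by linarith [hF.le_map_odds]
      _ ≤ a + (1 - a) * (F (odds b) + F (u + v)) := by gcongr
      _ ≤ a + (1 - a) * F (odds b + (u + v)) := by gcongr; exact hF.add_le _ _

lemma lexStep_add_le (hF : IsLexProfile a b F) (ha0 : 0 < a) (ha1 : a < 1) (hb0 : 0 < b)
    (hb : b ≤ 1 / 2) (x y : ℝ) :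
    lexStep a b F x + lexStep a b F y ≤ lexStep a b F (x + y) := by
  have hb1 : b < 1 := by linarith
  refine map_add_map_le_of_Ico _ (fun x y hx hxy hy => ?_) x y
  rcases lt_or_ge x b with hxb | hbx
  · obtain ⟨u, hu0, hu1, rfl⟩ := exists_eq_mul_of_lt hb0 hx hxb
    rw [lexStep_mul hb0 hb1 F hu0 hu1.le]
    rcases lt_or_ge y b with hyb | hby
    · obtain ⟨v, hv0, hv1, rfl⟩ := exists_eq_mul_of_lt hb0 (hx.trans hxy) hyb
      rw [lexStep_mul hb0 hb1 F hv0 hv1.le, ← mul_add, ← mul_add]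
      exact (mul_le_mul_of_nonneg_left (hF.add_le u v) ha0.le).trans
        (hF.mul_le_lexStep_mul hb0 hb (by positivity) (by linarith))
    · obtain ⟨v, hv0, hv1, rfl⟩ := exists_eq_add_mul_of_le hb1 hby hy.le
      rw [lexStep_add_mul hb0 hb1 hF.map_zero hv0 hv1]
      exact hF.lexStep_low_add_high_le ha0 ha1 hb0 hb1 hu0 hu1.le hv0 hv1
  · obtain ⟨u, hu0, hu1, rfl⟩ := exists_eq_add_mul_of_le hb1 hbx (hxy.trans hy.le)
    obtain ⟨v, hv0, hv1, rfl⟩ := exists_eq_add_mul_of_le hb1 (hbx.trans hxy) hy.le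
    rw [lexStep_add_mul hb0 hb1 hF.map_zero hu0 hu1, lexStep_add_mul hb0 hb1 hF.map_zero hv0 hv1]
    exact hF.lexStep_high_add_high_le ha1 hb0 hb1 hu0 hu1 hv0 hv1

lemma lexStep_le_map_odds_mul (hF : IsLexProfile a b F) (ha0 : 0 < a) (ha1 : a < 1) (hb0 : 0 < b)
    (hb : b ≤ 1 / 2) {x : ℝ} (hx0 : 0 ≤ x) (hx1 : x ≤ 1) :
    a * lexStep a b F x ≤ (1 - a) * lexStep a b F (odds b * x) := by
  have hb1 : b < 1 := by linarith
  have : 0 ≤ 1 - a := by linarith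
  have hθb := odds_mul_one_sub hb1
  have hθ := odds_pos hb0 hb1
  have hθ1 := odds_le_one hb
  rcases lt_or_ge x b with hxb | hbx
  · obtain ⟨r, hr0, hr1, rfl⟩ := exists_eq_mul_of_lt hb0 hx0 hxb
    rw [mul_left_comm (odds b), lexStep_mul hb0 hb1 F hr0 hr1.le,
      lexStep_mul hb0 hb1 F (by positivity) (mul_le_one₀ hθ1 hr0 hr1.le), mul_left_comm (1 - a)]
    exact mul_le_mul_of_nonneg_left (hF.le_map_odds_mul r hr0 hr1.le) ha0.le
  · obtain ⟨r, hr0, hr1, rfl⟩ := exists_eq_add_mul_of_le hb1 hbx hx1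
    have hθr : odds b * (b + (1 - b) * r) = b * (odds b + r) := by linear_combination r * hθb
    rw [hθr, lexStep_add_mul hb0 hb1 hF.map_zero hr0 hr1]
    calc a * (a + (1 - a) * F r) ≤ a * ((1 - a) * (F (odds b) + F r)) := by
          gcongr; linarith [hF.le_map_odds]
      _ ≤ (1 - a) * (a * F (odds b + r)) := by
          rw [mul_left_comm]; gcongr; exact hF.add_le _ _
      _ ≤ (1 - a) * lexStep a b F (b * (odds b + r)) := by
          gcongr; exact hF.mul_le_lexStep_mul hb0 hb (by positivity) (by linarith)

lemma lexStep_mul_of_nonpos (hF : IsLexProfile a b F) (hb0 : 0 < b) (hb1 : b < 1) {w : ℝ}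
    (hw1 : -1 ≤ w) (hw0 : w ≤ 0) : lexStep a b F ((1 - b) * w) = (1 - a) * F w := by
  have h : lexStep a b F ((1 - b) * w + 1) = a + (1 - a) * F (w + 1) := by
    rw [show (1 - b) * w + 1 = b + (1 - b) * (w + 1) by ring,
      lexStep_add_mul hb0 hb1 hF.map_zero (by linarith) (by linarith)]
  rw [AddConstMapClass.map_add_one, AddConstMapClass.map_add_one] at h
  linarith

lemma map_odds_mul_odds_mul_sub_one_le (hF : IsLexProfile a b F) (ha0 : 0 < a) (ha1 : a < 1)
    (hb0 : 0 < b) (hb : b ≤ 1 / 2) {y : ℝ} (hy1 : -1 ≤ y) (hy0 : y ≤ 0) :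
    (1 - a) * ((1 - a) * F (odds b * (odds b * y - 1))) ≤ a * (a * F y + a - 1) := by
  have : 0 ≤ 1 - a := by linarith
  have hθ0 := odds_pos hb0 (by linarith)
  have hθy0 : odds b * y ≤ 0 := mul_nonpos_of_nonneg_of_nonpos hθ0.le hy0
  have hθy1 : -1 ≤ odds b * y := by
    linarith [mul_le_mul (odds_le_one hb) (neg_le.1 hy1) (by linarith) zero_le_one]
  have hadd : F (odds b * (odds b * y - 1)) + F (odds b) ≤ F (odds b * (odds b * y)) := by
    convert hF.add_le (odds b * (odds b * y - 1)) (odds b) using 2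
    ring
  calc (1 - a) * ((1 - a) * F (odds b * (odds b * y - 1)))
      ≤ (1 - a) * ((1 - a) * F (odds b * (odds b * y)) - (1 - a) * F (odds b)) := by
        rw [← mul_sub]; gcongr; linarith
    _ ≤ (1 - a) * (a * F (odds b * y) - a) := by
        gcongr (1 - a) * ?_
        exact sub_le_sub (hF.map_odds_mul_le _ hθy1 hθy0) hF.le_map_odds
    _ = a * ((1 - a) * F (odds b * y) + a - 1) := by ring
    _ ≤ a * (a * F y + a - 1) := by gcongr a * (?_ + a - 1); exact hF.map_odds_mul_le y hy1 hy0

lemma map_odds_mul_add_le (hF : IsLexProfile a b F) (ha0 : 0 < a) (ha1 : a < 1) {y c : ℝ}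
    (hy1 : -1 ≤ y) (hy0 : y ≤ 0) (hc0 : 0 ≤ c) (hc1 : c ≤ 1) (hc : odds b * c = 1 - odds b) :
    (1 - a) * (a * F (odds b * y + c) + a - 1) ≤ a * (a * F y + a - 1) := by
  have : 0 ≤ 1 - a := by linarith
  have hadd : F (odds b * y + c) + F (-c) ≤ F (odds b * y) := by
    simpa using hF.add_le (odds b * y + c) (-c)
  have hc_le : 2 * a - 1 ≤ a * F (-c) := by
    have h := hF.map_odds_mul_le (-c) (by linarith) (by linarith)
    rw [show odds b * -c = odds b - 1 by linarith, AddConstMapClass.map_sub_one] at h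
    linarith [hF.le_map_odds]
  calc (1 - a) * (a * F (odds b * y + c) + a - 1)
      ≤ (1 - a) * (a * (F (odds b * y) - F (-c)) + a - 1) := by gcongr; linarith
    _ ≤ (1 - a) * (a * F (odds b * y) - a) := by gcongr (1 - a) * ?_; linarith
    _ = a * ((1 - a) * F (odds b * y) + a - 1) := by ring
    _ ≤ a * (a * F y + a - 1) := by gcongr a * (?_ + a - 1); exact hF.map_odds_mul_le y hy1 hy0

lemma lexStep_map_odds_mul_le_of_low (hF : IsLexProfile a b F) (ha0 : 0 < a) (ha1 : a < 1)
    (hb0 : 0 < b) (hb : b ≤ 1 / 2) {y : ℝ} (hy1 : -1 ≤ y) (hy0 : y ≤ 0) :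
    (1 - a) * lexStep a b F (odds b * (b * (y + 1) - 1)) ≤ a * (a * F y + a - 1) := by
  have hb1 : b < 1 := by linarith
  have hθb := odds_mul_one_sub hb1
  have hθ0 := odds_pos hb0 hb1
  have hθ1 := odds_le_one hb
  have hθy : odds b * y ≤ 0 := mul_nonpos_of_nonneg_of_nonpos hθ0.le hy0
  rcases le_total (-1) (odds b * (odds b * y - 1)) with hw | hw
  · have harg : odds b * (b * (y + 1) - 1) = (1 - b) * (odds b * (odds b * y - 1)) := by
      linear_combination -odds b * y * hθb
    rw [harg, hF.lexStep_mul_of_nonpos hb0 hb1 hw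
      (mul_nonpos_of_nonneg_of_nonpos hθ0.le (by linarith))]
    exact hF.map_odds_mul_odds_mul_sub_one_le ha0 ha1 hb0 hb hy1 hy0
  · obtain ⟨c, hc⟩ : ∃ c, odds b * c = 1 - odds b :=
      ⟨(1 - odds b) / odds b, mul_div_cancel₀ _ hθ0.ne'⟩
    have hc0 : 0 ≤ c := nonneg_of_mul_nonneg_right (by linarith) hθ0
    have hcy : c ≤ -(odds b * y) := le_of_mul_le_mul_left (by linarith) hθ0
    have hθy1 : -1 ≤ odds b * y := by
      linarith [mul_le_mul hθ1 (neg_le.1 hy1) (by linarith) zero_le_one]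
    have harg : odds b * (b * (y + 1) - 1) = b * (odds b * y + c + 1) - 1 := by
      linear_combination c * hθb - (1 - b) * hc
    rw [harg, AddConstMapClass.map_sub_one, lexStep_mul hb0 hb1 F (by linarith) (by linarith),
      AddConstMapClass.map_add_one, mul_add_one a]
    exact hF.map_odds_mul_add_le ha0 ha1 hy1 hy0 hc0 (by linarith) hc

lemma lexStep_map_odds_mul_le (hF : IsLexProfile a b F) (ha0 : 0 < a) (ha1 : a < 1) (hb0 : 0 < b)
    (hb : b ≤ 1 / 2) {x : ℝ} (hx1 : -1 ≤ x) (hx0 : x ≤ 0) :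
    (1 - a) * lexStep a b F (odds b * x) ≤ a * lexStep a b F x := by
  have hb1 : b < 1 := by linarith
  have hθ0 := odds_pos hb0 hb1
  have hθ1 := odds_le_one hb
  rcases lt_or_ge (x + 1) b with hxb | hbx
  · obtain ⟨r, hr0, hr1, hr⟩ := exists_eq_mul_of_lt hb0 (by linarith) hxb
    obtain ⟨y, rfl⟩ : ∃ y, r = y + 1 := ⟨r - 1, (sub_add_cancel r 1).symm⟩
    obtain rfl : x = b * (y + 1) - 1 := by linarith
    rw [AddConstMapClass.map_sub_one, lexStep_mul hb0 hb1 F hr0 hr1.le,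
      AddConstMapClass.map_add_one, mul_add_one a]
    exact hF.lexStep_map_odds_mul_le_of_low ha0 ha1 hb0 hb (by linarith) (by linarith)
  · obtain ⟨w, rfl⟩ : ∃ w, x = (1 - b) * w :=
      ⟨x / (1 - b), (mul_div_cancel₀ x (sub_pos.2 hb1).ne').symm⟩
    have hw0 : w ≤ 0 := nonpos_of_mul_nonpos_right hx0 (sub_pos.2 hb1)
    have hw1 : -1 ≤ w := le_of_mul_le_mul_left (by linarith) (sub_pos.2 hb1)
    have hθw : -1 ≤ odds b * w := by
      linarith [mul_le_mul hθ1 (neg_le.1 hw1) (by linarith) zero_le_one]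
    rw [mul_left_comm (odds b), hF.lexStep_mul_of_nonpos hb0 hb1 hw1 hw0,
      hF.lexStep_mul_of_nonpos hb0 hb1 hθw (mul_nonpos_of_nonneg_of_nonpos hθ0.le hw0),
      mul_left_comm a]
    exact mul_le_mul_of_nonneg_left (hF.map_odds_mul_le w hw1 hw0) (by linarith)

lemma lexStep_two_point_low_high (hF : IsLexProfile a b F) (ha0 : 0 < a) (ha1 : a < 1)
    (hb0 : 0 < b) (hb1 : b < 1) {u v : ℝ} (hu0 : 0 ≤ u) (hu1 : u ≤ 1) (hv0 : 0 ≤ v)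
    (hv1 : v ≤ 1) :
    (1 - a) * (a * F u) + a * (a + (1 - a) * F v) ≤
      lexStep a b F ((1 - b) * (b * u) + b * (b + (1 - b) * v)) := by
  have : 0 ≤ 1 - a := by linarith
  have hpoint : (1 - b) * (b * u) + b * (b + (1 - b) * v) = b * (b + (1 - b) * (u + v)) := by ring
  have hb' : 0 ≤ (1 - b) * (u + v) := mul_nonneg (by linarith) (by linarith)
  calc (1 - a) * (a * F u) + a * (a + (1 - a) * F v) = a * (a + (1 - a) * (F u + F v)) := by ring
    _ ≤ a * (a + (1 - a) * F (u + v)) := by gcongr; exact hF.add_le u v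
    _ ≤ _ := ?_
  rw [hpoint]
  rcases le_total (u + v) 1 with h | h
  · have hle : b + (1 - b) * (u + v) ≤ 1 := by
      linarith [mul_le_mul_of_nonneg_left h (sub_pos.2 hb1).le]
    rw [lexStep_mul hb0 hb1 F (by linarith) hle]
    gcongr
    simpa [hF.map_one, add_comm] using hF.two_point (u + v) 1 (by linarith) h le_rfl
  · have hcarry : b * (b + (1 - b) * (u + v)) = b + (1 - b) * (b * (u + v - 1)) := by ring
    rw [hcarry, lexStep_add_mul hb0 hb1 hF.map_zero (mul_nonneg hb0.le (by linarith))
      (mul_le_one₀ hb1.le (by linarith) (by linarith))]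
    have h2 := hF.two_point 0 (u + v - 1) le_rfl (by linarith) (by linarith)
    rw [hF.map_zero, mul_zero, mul_zero, zero_add, zero_add, AddConstMapClass.map_sub_one] at h2
    linarith [mul_le_mul_of_nonneg_left h2 this]

lemma lexStep_two_point (hF : IsLexProfile a b F) (ha0 : 0 < a) (ha1 : a < 1)
    (hb0 : 0 < b) (hb1 : b < 1) {x y : ℝ} (hx : 0 ≤ x) (hxy : x ≤ y) (hy : y ≤ 1) :
    (1 - a) * lexStep a b F x + a * lexStep a b F y ≤
      lexStep a b F ((1 - b) * x + b * y) := by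
  have hb' : 0 < 1 - b := sub_pos.2 hb1
  have hmem {u v : ℝ} (hu : 0 ≤ u) (huv : u ≤ v) (hv : v ≤ 1) :
      0 ≤ (1 - b) * u + b * v ∧ (1 - b) * u + b * v ≤ 1 := by
    constructor <;> nlinarith
  rcases lt_or_ge x b with hxb | hbx
  · obtain ⟨u, hu0, hu1, rfl⟩ := exists_eq_mul_of_lt hb0 hx hxb
    rw [lexStep_mul hb0 hb1 F hu0 hu1.le]
    rcases lt_or_ge y b with hyb | hby
    · obtain ⟨v, hv0, hv1, rfl⟩ := exists_eq_mul_of_lt hb0 (hx.trans hxy) hyb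
      have huv : u ≤ v := le_of_mul_le_mul_left hxy hb0
      obtain ⟨h0, h1⟩ := hmem hu0 huv hv1.le
      rw [lexStep_mul hb0 hb1 F hv0 hv1.le, mul_left_comm (1 - b), ← mul_add,
        lexStep_mul hb0 hb1 F h0 h1]
      linarith [mul_le_mul_of_nonneg_left (hF.two_point u v hu0 huv hv1.le) ha0.le]
    · obtain ⟨v, hv0, hv1, rfl⟩ := exists_eq_add_mul_of_le hb1 hby hy
      rw [lexStep_add_mul hb0 hb1 hF.map_zero hv0 hv1]
      exact hF.lexStep_two_point_low_high ha0 ha1 hb0 hb1 hu0 hu1.le hv0 hv1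
  · obtain ⟨u, hu0, hu1, rfl⟩ := exists_eq_add_mul_of_le hb1 hbx (hxy.trans hy)
    obtain ⟨v, hv0, hv1, rfl⟩ := exists_eq_add_mul_of_le hb1 (hbx.trans hxy) hy
    have huv : u ≤ v := le_of_mul_le_mul_left (by linarith) hb'
    obtain ⟨h0, h1⟩ := hmem hu0 huv hv1
    have hpoint : (1 - b) * (b + (1 - b) * u) + b * (b + (1 - b) * v) =
        b + (1 - b) * ((1 - b) * u + b * v) := by ring
    rw [lexStep_add_mul hb0 hb1 hF.map_zero hu0 hu1, lexStep_add_mul hb0 hb1 hF.map_zero hv0 hv1,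
      hpoint, lexStep_add_mul hb0 hb1 hF.map_zero h0 h1]
    linarith [mul_le_mul_of_nonneg_left (hF.two_point u v hu0 huv hv1) (sub_pos.2 ha1).le]

protected lemma lexStep (hF : IsLexProfile a b F) (ha0 : 0 < a) (ha1 : a < 1) (hb0 : 0 < b)
    (hb : b ≤ 1 / 2) : IsLexProfile a b (lexStep a b F) where
  map_zero := lexStep_zero hb0 (by linarith) hF.map_zero
  add_le := hF.lexStep_add_le ha0 ha1 hb0 hb
  le_map_odds_mul _ := hF.lexStep_le_map_odds_mul ha0 ha1 hb0 hb
  map_odds_mul_le _ := hF.lexStep_map_odds_mul_le ha0 ha1 hb0 hb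
  two_point _ _ := hF.lexStep_two_point ha0 ha1 hb0 (by linarith)

protected lemma lexStep_iterate (hF : IsLexProfile a b F) (ha0 : 0 < a) (ha1 : a < 1)
    (hb0 : 0 < b) (hb : b ≤ 1 / 2) (N : ℕ) : IsLexProfile a b ((lexStep a b)^[N] F) := by
  induction N with
  | zero => exact hF
  | succ N ih => rw [Function.iterate_succ_apply']; exact ih.lexStep ha0 ha1 hb0 hb

end IsLexProfile

section OddsRescale

/-- The total weight after the masses `x` and `1 - x` are weighted by `c` and `e`. -/
def totalWeight (c e x : ℝ) : ℝ :=
  c * x + e * (1 - x)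

/-- The probability whose odds are `c / e` times the odds of `x`. -/
noncomputable def oddsRescale (c e x : ℝ) : ℝ :=
  c * x / totalWeight c e x

variable {c e x y : ℝ}

lemma le_totalWeight (hce : c ≤ e) (hx : x ≤ 1) : c ≤ totalWeight c e x := by
  rw [totalWeight]
  linarith [mul_nonneg (sub_nonneg.2 hce) (sub_nonneg.2 hx)]

lemma totalWeight_pos (hc : 0 < c) (hce : c ≤ e) (hx : x ≤ 1) : 0 < totalWeight c e x :=
  hc.trans_le (le_totalWeight hce hx)

lemma totalWeight_anti (hce : c ≤ e) (hxy : x ≤ y) : totalWeight c e y ≤ totalWeight c e x := by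
  rw [totalWeight, totalWeight]
  linarith [mul_nonneg (sub_nonneg.2 hce) (sub_nonneg.2 hxy)]

lemma totalWeight_le (hce : c ≤ e) (hx : 0 ≤ x) : totalWeight c e x ≤ e := by
  simpa [totalWeight] using totalWeight_anti hce hx

lemma oddsRescale_zero : oddsRescale c e 0 = 0 := by simp [oddsRescale]

lemma oddsRescale_le_self (hc : 0 < c) (hce : c ≤ e) (hx0 : 0 ≤ x) (hx1 : x ≤ 1) :
    oddsRescale c e x ≤ x := by
  rw [oddsRescale, div_le_iff₀ (totalWeight_pos hc hce hx1), mul_comm]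
  exact mul_le_mul_of_nonneg_left (le_totalWeight hce hx1) hx0

lemma mul_le_mul_oddsRescale (hc : 0 < c) (hce : c ≤ e) (hx0 : 0 ≤ x) (hx1 : x ≤ 1) :
    c * x ≤ e * oddsRescale c e x := by
  rw [oddsRescale, mul_div_assoc', le_div_iff₀ (totalWeight_pos hc hce hx1), mul_comm]
  exact mul_le_mul_of_nonneg_right (totalWeight_le hce hx0) (by positivity)

lemma one_sub_oddsRescale (hc : 0 < c) (hce : c ≤ e) (hx : x ≤ 1) :
    1 - oddsRescale c e x = e * (1 - x) / totalWeight c e x := by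
  rw [oddsRescale, one_sub_div (totalWeight_pos hc hce hx).ne']
  simp only [totalWeight, add_sub_cancel_left]

lemma oddsRescale_sub_oddsRescale (hc : 0 < c) (hce : c ≤ e) (hx : x ≤ 1) (hy : y ≤ 1) :
    oddsRescale c e y - oddsRescale c e x =
      c * e * (y - x) / (totalWeight c e x * totalWeight c e y) := by
  have hX := (totalWeight_pos hc hce hx).ne'
  have hY := (totalWeight_pos hc hce hy).ne'
  rw [oddsRescale, oddsRescale, div_sub_div _ _ hY hX, mul_comm (totalWeight c e x)]
  congr 1
  simp only [totalWeight]
  ring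

lemma oddsRescale_add_le (hc : 0 < c) (hce : c ≤ e) (hx : 0 ≤ x) (hy : 0 ≤ y) (hxy : x + y ≤ 1) :
    oddsRescale c e x + oddsRescale c e y ≤ oddsRescale c e (x + y) := by
  have := totalWeight_pos hc hce hxy
  have hX : totalWeight c e (x + y) ≤ totalWeight c e x := totalWeight_anti hce (by linarith)
  have hY : totalWeight c e (x + y) ≤ totalWeight c e y := totalWeight_anti hce (by linarith)
  simp only [oddsRescale, mul_add, add_div]
  gcongr

lemma oddsRescale_add_le_of_one_le (hc : 0 < c) (hce : c ≤ e) (hx : x ≤ 1) (hy : y ≤ 1) :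
    oddsRescale c e x + oddsRescale c e y ≤ oddsRescale c e (x + y - 1) + 1 := by
  have he : 0 < e := hc.trans_le hce
  have hX := totalWeight_pos hc hce hx
  have hY := totalWeight_pos hc hce hy
  have : 0 ≤ 1 - x := sub_nonneg.2 hx
  have : 0 ≤ 1 - y := sub_nonneg.2 hy
  suffices h : 1 - oddsRescale c e (x + y - 1) ≤
      (1 - oddsRescale c e x) + (1 - oddsRescale c e y) by linarith
  rw [one_sub_oddsRescale hc hce hx, one_sub_oddsRescale hc hce hy,
    one_sub_oddsRescale hc hce (by linarith),
    show e * (1 - (x + y - 1)) = e * (1 - x) + e * (1 - y) by ring, add_div]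
  gcongr <;> exact totalWeight_anti hce (by linarith)

end OddsRescale

/-- The profile with which the iteration of `lexStep` is started: it divides odds by the ratio of
the odds of `b` and `a`, and is extended to `ℝ` by `F (x + 1) = F x + 1`. -/
noncomputable def oddsProfile (a b : ℝ) : ℝ →+c[1, 1] ℝ :=
  AddConstMap.mkFract 1 fun x => oddsRescale (a * (1 - b)) (b * (1 - a)) x

section OddsProfile

variable {a b x y : ℝ}

lemma oddsProfile_apply (ha0 : 0 < a) (hb1 : b < 1) (hx0 : 0 ≤ x) (hx1 : x ≤ 1) :
    oddsProfile a b x = oddsRescale (a * (1 - b)) (b * (1 - a)) x := by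
  rcases hx1.eq_or_lt with rfl | hx1
  · have hc : a * (1 - b) ≠ 0 := (mul_pos ha0 (sub_pos.2 hb1)).ne'
    have h0 : oddsProfile a b 0 = 0 := by
      rw [oddsProfile, mkFract_apply_of_mem _ ⟨le_rfl, zero_lt_one⟩, oddsRescale_zero]
    have h1 : oddsProfile a b 1 = 1 := by
      simpa [h0] using AddConstMapClass.map_one (oddsProfile a b)
    rw [h1, oddsRescale, totalWeight, sub_self, mul_zero, add_zero, mul_one, div_self hc]
  · rw [oddsProfile, mkFract_apply_of_mem _ ⟨hx0, hx1⟩]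

lemma oddsProfile_add_le (ha0 : 0 < a) (hab : a ≤ b) (hb1 : b < 1) (x y : ℝ) :
    oddsProfile a b x + oddsProfile a b y ≤ oddsProfile a b (x + y) := by
  have hc : 0 < a * (1 - b) := mul_pos ha0 (sub_pos.2 hb1)
  have hce : a * (1 - b) ≤ b * (1 - a) := by linarith
  refine map_add_map_le_of_Ico _ (fun x y hx hxy hy => ?_) x y
  have hy0 : 0 ≤ y := hx.trans hxy
  have hx1 : x ≤ 1 := hxy.trans hy.le
  rw [oddsProfile_apply ha0 hb1 hx hx1, oddsProfile_apply ha0 hb1 hy0 hy.le]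
  rcases le_total (x + y) 1 with h | h
  · rw [oddsProfile_apply ha0 hb1 (by linarith) h]
    exact oddsRescale_add_le hc hce hx hy0 h
  · rw [← sub_add_cancel (x + y) 1, AddConstMapClass.map_add_one,
      oddsProfile_apply ha0 hb1 (by linarith) (by linarith)]
    exact oddsRescale_add_le_of_one_le hc hce hx1 hy.le

lemma oddsProfile_le_map_odds_mul (ha0 : 0 < a) (hab : a ≤ b) (hb : b ≤ 1 / 2) (hx0 : 0 ≤ x)
    (hx1 : x ≤ 1) : a * oddsProfile a b x ≤ (1 - a) * oddsProfile a b (odds b * x) := by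
  have hb0 : 0 < b := ha0.trans_le hab
  have hb1 : b < 1 := by linarith
  have hc : 0 < a * (1 - b) := mul_pos ha0 (sub_pos.2 hb1)
  have hce : a * (1 - b) ≤ b * (1 - a) := by linarith
  have hθx0 : 0 ≤ odds b * x := mul_nonneg (odds_pos hb0 hb1).le hx0
  have hθx1 : odds b * x ≤ 1 := mul_le_one₀ (odds_le_one hb) hx0 hx1
  rw [oddsProfile_apply ha0 hb1 hx0 hx1, oddsProfile_apply ha0 hb1 hθx0 hθx1]
  calc a * oddsRescale (a * (1 - b)) (b * (1 - a)) x ≤ a * x := by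
        gcongr; exact oddsRescale_le_self hc hce hx0 hx1
    _ ≤ _ := ?_
  refine le_of_mul_le_mul_left ?_ hb0
  calc b * (a * x) = a * (1 - b) * (odds b * x) := by
        linear_combination -a * x * odds_mul_one_sub hb1
    _ ≤ b * (1 - a) * oddsRescale (a * (1 - b)) (b * (1 - a)) (odds b * x) :=
        mul_le_mul_oddsRescale hc hce hθx0 hθx1
    _ = _ := mul_assoc _ _ _

lemma oddsProfile_neg (ha0 : 0 < a) (hab : a ≤ b) (hb1 : b < 1) (hx0 : 0 ≤ x) (hx1 : x ≤ 1) :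
    oddsProfile a b (-x) =
      -(b * (1 - a) * x / totalWeight (a * (1 - b)) (b * (1 - a)) (1 - x)) := by
  have hc : 0 < a * (1 - b) := mul_pos ha0 (sub_pos.2 hb1)
  have h := one_sub_oddsRescale hc (by linarith : a * (1 - b) ≤ b * (1 - a)) (sub_le_self 1 hx0)
  have hmap : oddsProfile a b (1 - x) = oddsProfile a b (-x) + 1 := by
    rw [sub_eq_neg_add, AddConstMapClass.map_add_one]
  rw [← oddsProfile_apply ha0 hb1 (sub_nonneg.2 hx1) (sub_le_self 1 hx0), sub_sub_cancel, hmap] at h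
  linarith

lemma oddsProfile_map_odds_mul_le (ha0 : 0 < a) (hab : a ≤ b) (hb : b ≤ 1 / 2) (hx1 : -1 ≤ x)
    (hx0 : x ≤ 0) : (1 - a) * oddsProfile a b (odds b * x) ≤ a * oddsProfile a b x := by
  obtain ⟨d, rfl⟩ : ∃ d, x = -d := ⟨-x, (neg_neg x).symm⟩
  have hd0 : 0 ≤ d := neg_nonpos.1 hx0
  have hd1 : d ≤ 1 := neg_le_neg_iff.1 hx1
  have hb0 : 0 < b := ha0.trans_le hab
  have hb1 : b < 1 := by linarith
  have ha' : 0 < 1 - a := by linarith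
  have hc : 0 < a * (1 - b) := mul_pos ha0 (sub_pos.2 hb1)
  have hce : a * (1 - b) ≤ b * (1 - a) := by linarith
  have hθd0 : 0 ≤ odds b * d := mul_nonneg (odds_pos hb0 hb1).le hd0
  have hθd : odds b * d ≤ d := mul_le_of_le_one_left hd0 (odds_le_one hb)
  rw [mul_neg, oddsProfile_neg ha0 hab hb1 hθd0 (hθd.trans hd1),
    oddsProfile_neg ha0 hab hb1 hd0 hd1, mul_neg, mul_neg, neg_le_neg_iff, mul_div_assoc',
    mul_div_assoc']
  have := totalWeight_pos hc hce (sub_le_self 1 hθd0)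
  gcongr ?_ / ?_
  · calc a * (b * (1 - a) * d) ≤ (1 - a) * odds b * (b * (1 - a) * d) := by
          gcongr; exact le_one_sub_mul_odds hab hb1
      _ = (1 - a) * (b * (1 - a) * (odds b * d)) := by ring
  · exact totalWeight_anti hce (by linarith)

lemma mul_totalWeight_le_mul_totalWeight (ha0 : 0 < a) (hab : a ≤ b) (hb1 : b < 1) (hx : 0 ≤ x)
    (hy : y ≤ 1) : a * totalWeight (a * (1 - b)) (b * (1 - a)) ((1 - b) * x + b * y) ≤
      b * totalWeight (a * (1 - b)) (b * (1 - a)) y := by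
  have hc : 0 ≤ a * (1 - b) := mul_nonneg ha0.le (by linarith)
  have hce : a * (1 - b) ≤ b * (1 - a) := by linarith
  have hX := mul_le_mul_of_nonneg_left (totalWeight_le hce hx) hc
  have hY := mul_le_mul_of_nonneg_left (le_totalWeight hce hy) (hc.trans hce)
  simp only [totalWeight] at *
  linarith

lemma oddsProfile_two_point (ha0 : 0 < a) (hab : a ≤ b) (hb1 : b < 1) (hx : 0 ≤ x)
    (hxy : x ≤ y) (hy : y ≤ 1) :
    (1 - a) * oddsProfile a b x + a * oddsProfile a b y ≤
      oddsProfile a b ((1 - b) * x + b * y) := by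
  have hx1 : x ≤ 1 := hxy.trans hy
  have hb' : 0 ≤ 1 - b := (sub_pos.2 hb1).le
  have hb0 : 0 < b := ha0.trans_le hab
  have hc : 0 < a * (1 - b) := mul_pos ha0 (sub_pos.2 hb1)
  have hce : a * (1 - b) ≤ b * (1 - a) := by linarith
  have he : 0 < b * (1 - a) := hc.trans_le hce
  have hz0 : 0 ≤ (1 - b) * x + b * y := by have := hx.trans hxy; positivity
  have hz1 : (1 - b) * x + b * y ≤ 1 := by
    linarith [mul_le_mul_of_nonneg_left hx1 hb', mul_le_mul_of_nonneg_left hy hb0.le]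
  suffices h : a * (oddsProfile a b y - oddsProfile a b x) ≤
      oddsProfile a b ((1 - b) * x + b * y) - oddsProfile a b x by linarith
  rw [oddsProfile_apply ha0 hb1 hx hx1, oddsProfile_apply ha0 hb1 (hx.trans hxy) hy,
    oddsProfile_apply ha0 hb1 hz0 hz1, oddsRescale_sub_oddsRescale hc hce hx1 hy,
    oddsRescale_sub_oddsRescale hc hce hx1 hz1, show (1 - b) * x + b * y - x = b * (y - x) by ring]
  have hX := totalWeight_pos hc hce hx1
  have hY := totalWeight_pos hc hce hy
  have hZ := totalWeight_pos hc hce hz1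
  have hZY := mul_totalWeight_le_mul_totalWeight ha0 hab hb1 hx hy
  generalize totalWeight (a * (1 - b)) (b * (1 - a)) x = X at *
  generalize totalWeight (a * (1 - b)) (b * (1 - a)) y = Y at *
  generalize totalWeight (a * (1 - b)) (b * (1 - a)) ((1 - b) * x + b * y) = Z at *
  have : 0 ≤ y - x := sub_nonneg.2 hxy
  rw [mul_div_assoc', div_le_div_iff₀ (by positivity) (by positivity)]
  calc a * (a * (1 - b) * (b * (1 - a)) * (y - x)) * (X * Z)
      = a * (1 - b) * (b * (1 - a)) * (y - x) * X * (a * Z) := by ring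
    _ ≤ a * (1 - b) * (b * (1 - a)) * (y - x) * X * (b * Y) := by gcongr
    _ = _ := by ring

lemma isLexProfile_oddsProfile (ha0 : 0 < a) (hab : a ≤ b) (hb : b ≤ 1 / 2) :
    IsLexProfile a b (oddsProfile a b) where
  map_zero := by rw [oddsProfile_apply ha0 (by linarith) le_rfl zero_le_one, oddsRescale_zero]
  add_le := oddsProfile_add_le ha0 hab (by linarith)
  le_map_odds_mul _ := oddsProfile_le_map_odds_mul ha0 hab hb
  map_odds_mul_le _ := oddsProfile_map_odds_mul_le ha0 hab hb
  two_point _ _ := oddsProfile_two_point ha0 hab (by linarith)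

end OddsProfile

section Blocks

variable {a b : ℝ}

lemma mul_mul_one_sub_le_of_endpoints (ha0 : 0 < a) (ha1 : a < 1) (hb0 : 0 < b) (hb : b ≤ 1 / 2)
    {P q r : ℝ} (hP : 0 < P) (hq : 0 < q) (h0 : P * (1 - q * b) ≤ q * b)
    (h1 : P * (1 - q) ≤ a * q) (hr0 : 0 ≤ r) (hr1 : r ≤ 1) :
    P * ((1 - b) * r + b * (1 - a) * (1 - r)) * (1 - q * (b + (1 - b) * r)) ≤
      q * (b + (1 - b) * r) * totalWeight (a * (1 - b)) (b * (1 - a)) r := by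
  have : 0 < 1 - a := by linarith
  have hb' : 0 < 1 - b := by linarith
  have hr' : 0 ≤ 1 - r := sub_nonneg.2 hr1
  have hE : 0 < 1 - 2 * b + a * b := by linarith [mul_pos ha0 hb0]
  have h0' : 0 ≤ b * (1 - a) * (q * b - P * (1 - q * b)) :=
    mul_nonneg (by positivity) (sub_nonneg.2 h0)
  rw [totalWeight]
  -- The difference of the two sides is a quadratic in `r`: a concave one is bounded below by its
  -- chord, a convex one by its tangent at `0`, whose slope is nonnegative.
  rcases le_total (P * (1 - 2 * b + a * b)) (b - a) with hc | hc
  · have hleft := mul_nonneg h0' hr'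
    have hright : 0 ≤ (1 - b) * (a * q - P * (1 - q)) * r :=
      mul_nonneg (mul_nonneg hb'.le (sub_nonneg.2 h1)) hr0
    have hconcave : 0 ≤ q * (1 - b) * (b - a - P * (1 - 2 * b + a * b)) * (r * (1 - r)) :=
      mul_nonneg (mul_nonneg (by positivity) (sub_nonneg.2 hc)) (by positivity)
    linear_combination hleft + hright + hconcave
  · have hslope : 0 ≤ (1 - 2 * b + a * b) * (q * b - P * (1 - q * b)) * r :=
      mul_nonneg (mul_nonneg hE.le (sub_nonneg.2 h0)) hr0
    have hslope' : 0 ≤ P * q * (1 - b) * b * (1 - a) * r := by positivity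
    have hconvex : 0 ≤ q * (1 - b) * (P * (1 - 2 * b + a * b) - (b - a)) * (r * r) :=
      mul_nonneg (mul_nonneg (by positivity) (sub_nonneg.2 hc)) (by positivity)
    linear_combination h0' + hslope + hslope' + hconvex

lemma add_mul_oddsProfile (ha0 : 0 < a) (hab : a ≤ b) (hb1 : b < 1) {r : ℝ} (hr0 : 0 ≤ r)
    (hr1 : r ≤ 1) : a + (1 - a) * oddsProfile a b r =
      a * ((1 - b) * r + b * (1 - a) * (1 - r)) / totalWeight (a * (1 - b)) (b * (1 - a)) r := by
  have hc : 0 < a * (1 - b) := mul_pos ha0 (sub_pos.2 hb1)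
  have hD := totalWeight_pos hc (by linarith : a * (1 - b) ≤ b * (1 - a)) hr1
  rw [oddsProfile_apply ha0 hb1 hr0 hr1, oddsRescale, eq_div_iff hD.ne', add_mul, mul_assoc,
    div_mul_cancel₀ _ hD.ne', totalWeight]
  ring

lemma exists_eq_pow_mul (hb0 : 0 < b) (hb1 : b < 1) {s : ℝ} (hs0 : 0 < s) (hs1 : s ≤ 1) :
    ∃ k : ℕ, ∃ r, 0 ≤ r ∧ r ≤ 1 ∧ s = b ^ k * (b + (1 - b) * r) := by
  obtain ⟨k, hk, hk'⟩ := exists_nat_pow_near_of_lt_one hs0 hs1 hb0 hb1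
  have hq : 0 < b ^ k := pow_pos hb0 k
  obtain ⟨r, hr0, hr1, hr⟩ := exists_eq_add_mul_of_le hb1
    (by rw [le_div_iff₀ hq, ← pow_succ']; exact hk.le) ((div_le_one hq).2 hk')
  exact ⟨k, r, hr0, hr1, by rw [← hr, mul_div_cancel₀ s hq.ne']⟩

lemma exists_iterate_lexStep_mul_one_sub_le_mul (ha0 : 0 < a) (hab : a ≤ b) (hb : b ≤ 1 / 2)
    (h : ∀ k : ℕ, (1 - a) * a ^ k * (1 - b ^ k) ≤ a * b ^ k) {s : ℝ} (hs0 : 0 < s) (hs1 : s ≤ 1) :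
    ∃ N, (1 - a) * (lexStep a b)^[N] (oddsProfile a b) s * (1 - s) ≤ a * s := by
  have hb0 : 0 < b := ha0.trans_le hab
  have hb1 : b < 1 := by linarith
  have ha1 : a < 1 := by linarith
  have hc : 0 < a * (1 - b) := mul_pos ha0 (sub_pos.2 hb1)
  have hzero := (isLexProfile_oddsProfile ha0 hab hb).map_zero
  obtain ⟨k, r, hr0, hr1, rfl⟩ := exists_eq_pow_mul hb0 hb1 hs0 hs1
  have hblock0 : 0 ≤ b + (1 - b) * r := add_nonneg hb0.le (mul_nonneg (by linarith) hr0)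
  have hblock1 : b + (1 - b) * r ≤ 1 := by
    linarith [mul_le_mul_of_nonneg_left hr1 (sub_pos.2 hb1).le]
  have hD := totalWeight_pos hc (by linarith : a * (1 - b) ≤ b * (1 - a)) hr1
  have hright : (1 - a) * a ^ k * (1 - b ^ k * b) ≤ b ^ k * b := by
    refine le_of_mul_le_mul_left ?_ ha0
    calc a * ((1 - a) * a ^ k * (1 - b ^ k * b)) = (1 - a) * a ^ (k + 1) * (1 - b ^ (k + 1)) := by
          ring
      _ ≤ a * b ^ (k + 1) := h (k + 1)
      _ = a * (b ^ k * b) := by ring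
  refine ⟨k + 1, ?_⟩
  rw [Function.iterate_succ_apply, lexStep_iterate_pow_mul hb0 hb1 _ hblock0 hblock1,
    lexStep_add_mul hb0 hb1 hzero hr0 hr1, add_mul_oddsProfile ha0 hab hb1 hr0 hr1,
    mul_div_assoc', mul_div_assoc', div_mul_eq_mul_div, div_le_iff₀ hD]
  linarith [mul_le_mul_of_nonneg_left (mul_mul_one_sub_le_of_endpoints ha0 ha1 hb0 hb
    (mul_pos (sub_pos.2 ha1) (pow_pos ha0 k)) (pow_pos hb0 k) hright (h k) hr0 hr1) ha0.le]

lemma oddsProfile_mul_one_sub_le (ha0 : 0 < a) (hab : a ≤ b) (hb : b ≤ 1 / 2) {m : ℝ}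
    (hm0 : 0 ≤ m) (hmb : m ≤ b) : oddsProfile a b m * (1 - m) ≤ a * (1 - b) := by
  have hb1 : b < 1 := by linarith
  have hc : 0 < a * (1 - b) := mul_pos ha0 (sub_pos.2 hb1)
  have hm1 : m ≤ 1 := hmb.trans hb1.le
  have hm : m * (1 - m) ≤ totalWeight (a * (1 - b)) (b * (1 - a)) m := by
    rw [totalWeight]
    linarith [mul_nonneg (sub_nonneg.2 hmb) (by linarith : 0 ≤ 1 - a - m)]
  rw [oddsProfile_apply ha0 hb1 hm0 hm1, oddsRescale, div_mul_eq_mul_div,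
    div_le_iff₀ (totalWeight_pos hc (by linarith) hm1), mul_assoc]
  exact mul_le_mul_of_nonneg_left hm hc.le

lemma exists_iterate_lexStep_mul_one_sub_le (ha0 : 0 < a) (hab : a ≤ b) (hb : b ≤ 1 / 2)
    (h : ∀ k : ℕ, (1 - a) * a ^ k * (1 - b ^ k) ≤ a * b ^ k) {m : ℝ} (hm0 : 0 ≤ m) (hm1 : m ≤ 1) :
    ∃ N, (lexStep a b)^[N] (oddsProfile a b) m * (1 - m) ≤ a * (1 - b) := by
  have hb0 : 0 < b := ha0.trans_le hab
  have hb1 : b < 1 := by linarith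
  rcases le_or_gt m b with hmb | hbm
  · exact ⟨0, oddsProfile_mul_one_sub_le ha0 hab hb hm0 hmb⟩
  obtain ⟨s, hs0, hs1, rfl⟩ := exists_eq_add_mul_of_le hb1 hbm.le hm1
  have hs : 0 < s := pos_of_mul_pos_right (by linarith) (sub_pos.2 hb1).le
  obtain ⟨N, hN⟩ := exists_iterate_lexStep_mul_one_sub_le_mul ha0 hab hb h hs hs1
  have hzero := ((isLexProfile_oddsProfile ha0 hab hb).lexStep_iterate ha0 (by linarith) hb0 hb
    N).map_zero
  refine ⟨N + 1, ?_⟩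
  rw [Function.iterate_succ_apply', lexStep_add_mul hb0 hb1 hzero hs0 hs1]
  linarith [mul_le_mul_of_nonneg_left hN (sub_pos.2 hb1).le]

end Blocks

section BiasedMeasure

open Finset

variable {ι : Type*} {p : ℝ}

/-- The `p`-biased measure of the subsets of `S` that belong to `U`; varying `S` allows induction
on the number of coordinates. -/
noncomputable def biasedMeasureOn (p : ℝ) (S : Finset ι) (U : Set (Finset ι)) : ℝ :=
  ∑ A ∈ S.powerset, U.indicator (fun A => p ^ #A * (1 - p) ^ (#S - #A)) A

lemma biasedMeasureOn_insert [DecidableEq ι] (p : ℝ) {S : Finset ι} {x : ι} (hx : x ∉ S)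
    (U : Set (Finset ι)) :
    biasedMeasureOn p (insert x S) U =
      (1 - p) * biasedMeasureOn p S U + p * biasedMeasureOn p S {A | insert x A ∈ U} := by
  classical
  rw [biasedMeasureOn, sum_powerset_insert hx, biasedMeasureOn, biasedMeasureOn, mul_sum, mul_sum]
  congr 1
  · refine sum_congr rfl fun A hA => ?_
    simp only [Set.indicator_apply]
    rw [card_insert_of_notMem hx, Nat.sub_add_comm (card_le_card (mem_powerset.1 hA)), pow_succ]
    split_ifs <;> ring
  · refine sum_congr rfl fun A hA => ?_
    simp only [Set.indicator_apply, Set.mem_ofPred_eq]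
    rw [card_insert_of_notMem hx, card_insert_of_notMem fun h => hx (mem_powerset.1 hA h),
      Nat.add_sub_add_right, pow_succ]
    split_ifs <;> ring

lemma biasedMeasureOn_mono (hp0 : 0 ≤ p) (hp1 : p ≤ 1) (S : Finset ι) {U V : Set (Finset ι)}
    (h : U ⊆ V) : biasedMeasureOn p S U ≤ biasedMeasureOn p S V :=
  sum_le_sum fun A _ => Set.indicator_le_indicator_of_subset h
    (fun A => mul_nonneg (pow_nonneg hp0 #A) (pow_nonneg (sub_nonneg.2 hp1) _)) A

lemma biasedMeasureOn_empty (p : ℝ) (S : Finset ι) : biasedMeasureOn p S ∅ = 0 := by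
  simp [biasedMeasureOn]

lemma biasedMeasureOn_univ (p : ℝ) (S : Finset ι) : biasedMeasureOn p S Set.univ = 1 := by
  simp [biasedMeasureOn, sum_pow_mul_eq_add_pow]

lemma biasedMeasureOn_nonneg (hp0 : 0 ≤ p) (hp1 : p ≤ 1) (S : Finset ι) (U : Set (Finset ι)) :
    0 ≤ biasedMeasureOn p S U :=
  (biasedMeasureOn_empty p S).ge.trans (biasedMeasureOn_mono hp0 hp1 S U.empty_subset)

lemma biasedMeasureOn_le_one (hp0 : 0 ≤ p) (hp1 : p ≤ 1) (S : Finset ι) (U : Set (Finset ι)) :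
    biasedMeasureOn p S U ≤ 1 :=
  (biasedMeasureOn_mono hp0 hp1 S U.subset_univ).trans (biasedMeasureOn_univ p S).le

lemma biasedMeasureOn_compl (p : ℝ) (S : Finset ι) (U : Set (Finset ι)) :
    biasedMeasureOn p S Uᶜ = 1 - biasedMeasureOn p S U := by
  rw [eq_sub_iff_add_eq', ← biasedMeasureOn_univ p S, biasedMeasureOn, biasedMeasureOn,
    biasedMeasureOn, ← sum_add_distrib]
  exact sum_congr rfl fun A _ => by
    rw [Set.indicator_univ, Set.indicator_self_add_compl_apply]

lemma biasedMeasureOn_one_sub_sdiff [DecidableEq ι] (p : ℝ) (S : Finset ι) (U : Set (Finset ι)) :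
    biasedMeasureOn (1 - p) S {A | S \ A ∈ U} = biasedMeasureOn p S U := by
  classical
  refine sum_nbij' (S \ ·) (S \ ·) (by simp) (by simp)
    (fun A hA => by simpa using hA) (fun A hA => by simpa using hA) fun A hA => ?_
  have hA' := mem_powerset.1 hA
  simp only [Set.indicator_apply, Set.mem_ofPred_eq]
  rw [card_sdiff_of_subset hA', Nat.sub_sub_self (card_le_card hA'), sub_sub_cancel, mul_comm]

lemma biasedMeasureOn_le_of_two_point {a b : ℝ} (ha0 : 0 ≤ a) (ha1 : a ≤ 1) (hb0 : 0 ≤ b)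
    (hb1 : b ≤ 1) {f : ℝ → ℝ} (hf0 : 0 ≤ f 0) (hf1 : 1 ≤ f 1)
    (hf : ∀ x y, 0 ≤ x → x ≤ y → y ≤ 1 → (1 - a) * f x + a * f y ≤ f ((1 - b) * x + b * y))
    (S : Finset ι) {U : Set (Finset ι)} (hU : IsUpperSet U) :
    biasedMeasureOn a S U ≤ f (biasedMeasureOn b S U) := by
  classical
  induction S using Finset.induction_on generalizing U with
  | empty => by_cases h : ∅ ∈ U <;> simp [biasedMeasureOn, h, hf0, hf1]
  | insert x S hx ih =>
    have hUx : IsUpperSet {A | insert x A ∈ U} := fun A B hAB hA =>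
      hU (insert_subset_insert x hAB) hA
    have hsub : U ⊆ {A | insert x A ∈ U} := fun A hA => hU (subset_insert x A) hA
    rw [biasedMeasureOn_insert a hx, biasedMeasureOn_insert b hx]
    calc _ ≤ (1 - a) * f (biasedMeasureOn b S U) +
          a * f (biasedMeasureOn b S {A | insert x A ∈ U}) :=
          add_le_add (mul_le_mul_of_nonneg_left (ih hU) (sub_nonneg.2 ha1))
            (mul_le_mul_of_nonneg_left (ih hUx) ha0)
      _ ≤ _ := hf _ _ (biasedMeasureOn_nonneg hb0 hb1 S U) (biasedMeasureOn_mono hb0 hb1 S hsub)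
          (biasedMeasureOn_le_one hb0 hb1 S _)

variable {n : ℕ}

lemma biasedMeasure_eq_biasedMeasureOn (p : ℝ) (F : Finset (Finset (Fin n))) :
    biasedMeasure p F = biasedMeasureOn p univ (F : Set (Finset (Fin n))) := by
  simp [biasedMeasure, biasedMeasureOn, Set.indicator_apply]

lemma biasedMeasure_le_upperClosure (hp0 : 0 ≤ p) (hp1 : p ≤ 1) (F : Finset (Finset (Fin n))) :
    biasedMeasure p F ≤
      biasedMeasureOn p univ (upperClosure (F : Set (Finset (Fin n))) : Set (Finset (Fin n))) := by
  rw [biasedMeasure_eq_biasedMeasureOn]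
  exact biasedMeasureOn_mono hp0 hp1 univ subset_upperClosure

lemma biasedMeasure_nonneg (hp0 : 0 ≤ p) (hp1 : p ≤ 1) (F : Finset (Finset (Fin n))) :
    0 ≤ biasedMeasure p F :=
  (biasedMeasureOn_nonneg hp0 hp1 univ _).trans_eq (biasedMeasure_eq_biasedMeasureOn p F).symm

lemma biasedMeasure_star (p : ℝ) (n : ℕ) [NeZero n] :
    biasedMeasure p (univ.filter fun A : Finset (Fin n) => 0 ∈ A) = p := by
  have hcoe : ((univ.filter fun A : Finset (Fin n) => 0 ∈ A) : Set (Finset (Fin n))) =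
      {A | 0 ∈ A} := by simp
  have hempty : biasedMeasureOn p (univ.erase (0 : Fin n)) {A | 0 ∈ A} = 0 :=
    sum_eq_zero fun A hA => Set.indicator_of_notMem (s := {A : Finset (Fin n) | 0 ∈ A})
      (fun h0 => notMem_erase 0 univ (mem_powerset.1 hA h0)) _
  rw [biasedMeasure_eq_biasedMeasureOn, hcoe, ← insert_erase (mem_univ (0 : Fin n)),
    biasedMeasureOn_insert p (notMem_erase 0 univ), hempty]
  simp [biasedMeasureOn_univ]

end BiasedMeasure

section ModifiedStar

open Finset

lemma initSegment_self (n : ℕ) : initSegment n n = univ := by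
  simp [initSegment]

lemma biasedMeasure_modifiedStarA (p : ℝ) (j : ℕ) :
    biasedMeasure p (modifiedStarA (j + 2) j) = p + p ^ (j + 1) * (1 - p) := by
  have hA : modifiedStarA (j + 2) j =
      (univ.filter fun A : Finset (Fin (j + 2)) => 0 ∈ A) ∪ {univ \ {0}} := by
    ext A
    simp [modifiedStarA, initSegment_self, or_comm]
  rw [hA, biasedMeasure, sum_union (by simp), ← biasedMeasure, biasedMeasure_star, sum_singleton,
    card_sdiff_of_subset (subset_univ _)]
  simp

lemma biasedMeasure_modifiedStarB (p : ℝ) (j : ℕ) :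
    biasedMeasure p (modifiedStarB (j + 2) j) = p - p * (1 - p) ^ (j + 1) := by
  have hB : modifiedStarB (j + 2) j =
      (univ.filter fun A : Finset (Fin (j + 2)) => 0 ∈ A) \ {{0}} := by
    ext A
    simp [modifiedStarB, initSegment_self]
  have hsum := sum_sdiff (f := fun A : Finset (Fin (j + 2)) => p ^ #A * (1 - p) ^ (j + 2 - #A))
    (show {{0}} ⊆ univ.filter fun A : Finset (Fin (j + 2)) => 0 ∈ A by simp)
  rw [← biasedMeasure, sum_singleton, ← biasedMeasure, biasedMeasure_star] at hsum
  rw [hB, eq_sub_iff_add_eq]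
  simpa using hsum

lemma mul_pow_mul_one_sub_pow_le_of_modifiedStar {α β : ℝ} (hα : 0 ≤ α) (hβ : 0 < β)
    (h : ∀ j : ℕ, biasedMeasure α (modifiedStarA (j + 2) j) *
      biasedMeasure β (modifiedStarB (j + 2) j) ≤ α * β) (k : ℕ) :
    (1 - α) * α ^ k * (1 - (1 - β) ^ k) ≤ α * (1 - β) ^ k := by
  rcases k with _ | j
  · simpa using hα
  · have hj := h j
    rw [biasedMeasure_modifiedStarA, biasedMeasure_modifiedStarB] at hj
    refine le_of_mul_le_mul_left ?_ hβ
    linear_combination hj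

end ModifiedStar

section CrossIntersecting

open Finset

variable {n : ℕ}

lemma CrossIntersecting.biasedMeasure_le {F G : Finset (Finset (Fin n))}
    (hFG : CrossIntersecting F G) {p : ℝ} (hp0 : 0 ≤ p) (hp1 : p ≤ 1) :
    biasedMeasure p G ≤ 1 - biasedMeasureOn (1 - p) univ
      (upperClosure (F : Set (Finset (Fin n))) : Set (Finset (Fin n))) := by
  rw [biasedMeasure_eq_biasedMeasureOn, ← biasedMeasureOn_compl, ← biasedMeasureOn_one_sub_sdiff]
  refine biasedMeasureOn_mono (sub_nonneg.2 hp1) (sub_le_self 1 hp0) univ fun B hB hmem => ?_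
  obtain ⟨A, hA, hAB⟩ := mem_upperClosure.1 hmem
  obtain ⟨i, hi⟩ := hFG A hA _ hB
  rw [mem_inter] at hi
  exact (mem_sdiff.1 hi.2).2 (hAB hi.1)

lemma crossIntersecting_star (n : ℕ) [NeZero n] :
    CrossIntersecting (univ.filter fun A : Finset (Fin n) => 0 ∈ A)
      (univ.filter fun A : Finset (Fin n) => 0 ∈ A) :=
  fun _ hA _ hB => ⟨0, mem_inter.2 ⟨(mem_filter.1 hA).2, (mem_filter.1 hB).2⟩⟩

lemma CrossIntersecting.biasedMeasure_mul_le {F G : Finset (Finset (Fin n))}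
    (hFG : CrossIntersecting F G) {α β : ℝ} (hα : 0 < α) (hβ : 1 / 2 ≤ β) (hαβ : α + β ≤ 1)
    (h : ∀ k : ℕ, (1 - α) * α ^ k * (1 - (1 - β) ^ k) ≤ α * (1 - β) ^ k) :
    biasedMeasure α F * biasedMeasure β G ≤ α * β := by
  let U : Set (Finset (Fin n)) := ↑(upperClosure (F : Set (Finset (Fin n))))
  let m := biasedMeasureOn (1 - β) univ U
  have hβ0 : 0 ≤ β := by linarith
  have hβ1 : β ≤ 1 := by linarith
  have hα1 : α < 1 := by linarith
  have hab : α ≤ 1 - β := by linarith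
  have hb : 1 - β ≤ 1 / 2 := by linarith
  have hb0 : 0 < 1 - β := hα.trans_le hab
  have hm0 : 0 ≤ m := biasedMeasureOn_nonneg hb0.le (by linarith) univ U
  have hm1 : m ≤ 1 := biasedMeasureOn_le_one hb0.le (by linarith) univ U
  obtain ⟨N, hN⟩ := exists_iterate_lexStep_mul_one_sub_le hα hab hb h hm0 hm1
  have hprofile := (isLexProfile_oddsProfile hα hab hb).lexStep_iterate hα hα1 hb0 hb N
  have hU : biasedMeasureOn α univ U ≤ (lexStep α (1 - β))^[N] (oddsProfile α (1 - β)) m :=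
    biasedMeasureOn_le_of_two_point hα.le hα1.le hb0.le (by linarith) hprofile.map_zero.ge
      hprofile.map_one.ge hprofile.two_point univ (upperClosure _).upper
  calc biasedMeasure α F * biasedMeasure β G ≤ biasedMeasureOn α univ U * (1 - m) :=
        mul_le_mul (biasedMeasure_le_upperClosure hα.le hα1.le F) (hFG.biasedMeasure_le hβ0 hβ1)
          (biasedMeasure_nonneg hβ0 hβ1 G) (biasedMeasureOn_nonneg hα.le hα1.le univ U)
    _ ≤ (lexStep α (1 - β))^[N] (oddsProfile α (1 - β)) m * (1 - m) :=
        mul_le_mul_of_nonneg_right hU (sub_nonneg.2 hm1)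
    _ ≤ α * (1 - (1 - β)) := hN
    _ = α * β := by rw [sub_sub_cancel]

end CrossIntersecting

theorem theorem1_general (α β : ℝ) (hα : 0 < α) (hβ : 1 / 2 ≤ β) (hαβ : α + β ≤ 1)
    (h : ∀ j : ℕ,
      biasedMeasure α (modifiedStarA (j + 2) j) * biasedMeasure β (modifiedStarB (j + 2) j)
        ≤ α * β)
    (n : ℕ) (hn : 1 ≤ n) :
    IsGreatest (crossProducts n α β) (α * β) := by
  have : NeZero n := ⟨by omega⟩
  refine ⟨⟨_, _, crossIntersecting_star n, by rw [biasedMeasure_star, biasedMeasure_star]⟩, ?_⟩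
  rintro _ ⟨F, G, hFG, rfl⟩
  exact hFG.biasedMeasure_mul_le hα hβ hαβ
    (mul_pow_mul_one_sub_pow_le_of_modifiedStar hα.le (by linarith) h)

/-- The values `μ_α(A_j)` and `μ_β(B_j)` do not depend on the size of the ground set, as long as
it contains `[j + 2]`; the hypothesis evaluates them on the ground set `[j + 2]`. -/
theorem theorem1 (α β : ℝ) (hαβ : (α, β) ∈ triangleOmega)
    (h : ∀ j : ℕ,
      biasedMeasure α (modifiedStarA (j + 2) j) * biasedMeasure β (modifiedStarB (j + 2) j)
        < α * β)
    (n : ℕ) (hn : 1 ≤ n) :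
    IsGreatest (crossProducts n α β) (α * β) := by
  obtain ⟨hα, hβ, hs⟩ := hαβ
  exact theorem1_general α β hα hβ.le hs.le (fun j => (h j).le) n hn
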